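/- All graphs are finite and simple. A graph $G$ on $n$ vertices is \emph{path-pairable} if, with $k=\lfloor n/2\rfloor$, for any two disjoint sets $\{x_1,\dots,x_k\}$ and $\{y_1,\dots,y_k\}$ of $k$ distinct vertices of $G$ each, there exist pairwise edge-disjoint paths $P_1,\dots,P_k$ in $G$ such that $P_i$ joins $x_i$ to $y_i$ for $1\le i\le k$. The graph $G$ is \emph{$c$-degenerate} if its vertices have an ordering $v_1,\dots,v_n$ such that $|\{v_j : j>i,\ v_iv_j\in E(G)\}|\le c$ for all $i=1,\dots,n$. For $n\ge 1$, let $d(n,\mathcal G_{c\text{-deg}})$ denote the maximum diameter of a path-pairable $c$-degenerate graph on $n$ vertices. Let $c\ge 5$ be a fixed integer. Then the maximum $d(n,\mathcal G_{c\text{-deg}})$ exists and is finite for every $n\ge 1$, and $$(2+o(1))\,\frac{\log n}{\log\left(\frac{c}{c-2}\right)}\;\le\; d(n,\mathcal G_{c\text{-deg}})\;\le\;(12+o(1))\,\frac{\log n}{\log\left(\frac{c}{c-2}\right)}$$ as $n\to\infty$, where the $o(1)$ terms may depend on $c$. -/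

import Mathlib

open Filter Topology

namespace PathPairability

/-- `G` is `k`-path-pairable: it has at least `2k` vertices, and for any two disjoint sets of `k`
distinct vertices `{x₁, …, xₖ}` and `{y₁, …, yₖ}` there are pairwise edge-disjoint paths
`P₁, …, Pₖ` such that `Pᵢ` joins `xᵢ` to `yᵢ`. -/
def IsKPathPairable {V : Type*} [Fintype V] (G : SimpleGraph V) (k : ℕ) : Prop :=
  2 * k ≤ Fintype.card V ∧
    ∀ x y : Fin k → V, Function.Injective x → Function.Injective y →
      Disjoint (Set.range x) (Set.range y) →
      ∃ P : ∀ i : Fin k, G.Walk (x i) (y i),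
        (∀ i, (P i).IsPath) ∧
        ∀ i j, i ≠ j → List.Disjoint (P i).edges (P j).edges

/-- A graph on `2k` or `2k + 1` vertices is path-pairable if it is `k`-path-pairable. -/
def IsPathPairable {V : Type*} [Fintype V] (G : SimpleGraph V) : Prop :=
  ∃ k : ℕ, (Fintype.card V = 2 * k ∨ Fintype.card V = 2 * k + 1) ∧ IsKPathPairable G k

/-- `G` is `c`-degenerate: its vertices can be ordered in such a way that every vertex has at most
`c` neighbours that come later in the ordering. -/
def IsDegenerate {V : Type*} [Fintype V] (c : ℕ) (G : SimpleGraph V) : Prop :=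
  ∃ v : Fin (Fintype.card V) ≃ V,
    ∀ i, Set.ncard {j | i < j ∧ G.Adj (v i) (v j)} ≤ c

/-- The family of `c`-degenerate graphs, on the vertex sets `Fin n`. -/
def degenerateFamily (c : ℕ) (n : ℕ) : Set (SimpleGraph (Fin n)) :=
  {G | IsDegenerate c G}

/-- The set of the diameters (in `ℕ∞`, so that a disconnected graph has diameter `⊤`) of the
path-pairable graphs on `n` vertices in the family `𝒢`. -/
def diameters (n : ℕ) (𝒢 : (n : ℕ) → Set (SimpleGraph (Fin n))) : Set ℕ∞ :=
  {D | ∃ G ∈ 𝒢 n, IsPathPairable G ∧ G.ediam = D}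

/-- `d(n, 𝒢)`: the maximum diameter of a path-pairable graph on `n` vertices in the family `𝒢`. -/
noncomputable def maxDiam (n : ℕ) (𝒢 : (n : ℕ) → Set (SimpleGraph (Fin n))) : ℕ :=
  (sSup (diameters n 𝒢)).toNat

end PathPairability

/-!
The upper bound is an edge count. In a path-pairable graph on `2k` or `2k + 1` vertices, each set
of at most `k` vertices can be paired with vertices outside, so at least as many edges leave the
set as it has vertices (`IsKPathPairable.exists_walks_leaving`). In particular the graph is
connected. Let `U₀ ⊆ U₁ ⊆ ⋯` be the balls around an end of a longest geodesic. The edges leaving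
`U₀, …, U_{t-1}` are different and lie inside `U_t`, which has at most `c |U_t|` edges by
degeneracy, so `|U₀| + ⋯ + |U_{t-1}| ≤ c |U_t|` as long as `|U_t| ≤ k`
(`sum_card_closedBall_le`). Hence these sums grow by a factor `1 + 1/c` in each step, and the
radius at which a ball reaches half of the graph is at most `log n / log (1 + 1/c) + O(1)`. Two such
balls around the ends of the geodesic cannot be disjoint, and
`log (c / (c - 2)) ≤ 6 log (1 + 1/c)`.

For the lower bound put `b = ⌊(c - 1) / 2⌋ ≥ 2`. Take two copies of a sequence of layers, in which
the sizes grow by the factor `(b + 1) / b ≤ c / (c - 2)` up to rounding, and join the last layers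
and some filler vertices to `2b + 1 ≤ c` hubs (`layeredGraph`). Each vertex starts a token; every
vertex of a layer passes on at most `b + 1` tokens along different edges to the next layer, where
each vertex receives at most `b` of them and adds its own. So all vertices are connected to
the neighbours of the hubs by edge-disjoint walks which do not depend on the pairing, at most
`b + 1` to the same neighbour. Two tokens that are paired meet via a hub, and as each end
excludes at most `b` hubs, the hubs can be assigned greedily (`isKPathPairable_of_hubs`). The hubs
themselves send their tokens to fillers, which requires `b ≥ 2`. The order that lists the layers
from the first to the last, then the fillers and the hubs shows that the graph is `c`-degenerate,
and the first layers of the two copies are at distance at least `2m + 2` if the layers are numbered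
`0, …, m`, where `m = log n / log ((b + 1) / b) - O(1)`.
-/

namespace PathPairability

/-! ### Cuts in path-pairable graphs and edges of degenerate graphs -/

/-- Walks suffice: a walk contains a path with the same ends and no new edges. -/
theorem isKPathPairable_of_walks {V : Type*} [Fintype V] {G : SimpleGraph V} {k : ℕ}
    (hk : 2 * k ≤ Fintype.card V)
    (h : ∀ x y : Fin k → V, Function.Injective x → Function.Injective y →
      Disjoint (Set.range x) (Set.range y) →
      ∃ P : ∀ i : Fin k, G.Walk (x i) (y i),
        ∀ i j, i ≠ j → List.Disjoint (P i).edges (P j).edges) :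
    IsKPathPairable G k := by
  classical
  refine ⟨hk, fun x y hx hy hxy => ?_⟩
  obtain ⟨P, hP⟩ := h x y hx hy hxy
  refine ⟨fun i => (P i).bypass, fun i => (P i).bypass_isPath, fun i j hij e he he' => ?_⟩
  exact hP i j hij ((P i).edges_bypass_subset_edges he) ((P j).edges_bypass_subset_edges he')

/-- The cut condition: at most `k` vertices can be left simultaneously along edge-disjoint
walks, since all of them may be paired with vertices outside. -/
theorem IsKPathPairable.exists_walks_leaving {V : Type*} [Fintype V] [DecidableEq V]
    {G : SimpleGraph V} {k : ℕ}
    (h : IsKPathPairable G k) (U : Finset V) (hU : U.card ≤ k) :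
    ∃ (z : U → V) (P : ∀ w : U, G.Walk w (z w)), (∀ w, z w ∉ U) ∧
      ∀ w w' : U, w ≠ w' → List.Disjoint (P w).edges (P w').edges := by
  obtain ⟨hk, h⟩ := h
  obtain ⟨A, hUA, -, hA⟩ := Finset.exists_subsuperset_card_eq (Finset.subset_univ U) hU
    (by rw [Finset.card_univ]; omega)
  obtain ⟨B, hBA, hB⟩ := Finset.exists_subset_card_eq (s := Aᶜ) (n := k)
    (by rw [Finset.card_compl]; omega)
  let x : Fin k → V := fun i => (A.equivFinOfCardEq hA).symm i
  let y : Fin k → V := fun i => (B.equivFinOfCardEq hB).symm i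
  have hyA : ∀ i, y i ∉ A := fun i => by
    have := hBA ((B.equivFinOfCardEq hB).symm i).2
    simpa using this
  obtain ⟨P, -, hP⟩ := h x y
    (fun i j hij => (A.equivFinOfCardEq hA).symm.injective (Subtype.ext hij))
    (fun i j hij => (B.equivFinOfCardEq hB).symm.injective (Subtype.ext hij))
    (by
      rw [Set.disjoint_left]
      rintro _ ⟨i, rfl⟩ ⟨j, hj⟩
      apply hyA j
      rw [hj]
      exact ((A.equivFinOfCardEq hA).symm i).2)
  let idx : U → Fin k := fun w => A.equivFinOfCardEq hA ⟨w, hUA w.2⟩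
  have hidx : ∀ w : U, x (idx w) = w := fun w => by simp [x, idx]
  refine ⟨fun w => y (idx w), fun w => (P (idx w)).copy (hidx w) rfl,
    fun w hw => hyA _ (hUA hw), fun w w' hww' => ?_⟩
  simp only [SimpleGraph.Walk.edges_copy]
  refine hP _ _ fun he => hww' ?_
  have := congrArg x he
  rw [hidx, hidx] at this
  exact Subtype.ext this

theorem IsPathPairable.connected {V : Type*} [Fintype V] [Nonempty V] {G : SimpleGraph V}
    (h : IsPathPairable G) : G.Connected := by
  classical
  obtain ⟨k, hk, h⟩ := h
  -- neither a union of components nor its complement can be left by a walk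
  have key : ∀ U : Finset V, U.Nonempty → U.card ≤ k → (∀ a b, G.Adj a b → a ∈ U → b ∈ U) →
      False := by
    rintro U ⟨w, hw⟩ hU hcl
    obtain ⟨z, P, hz, -⟩ := h.exists_walks_leaving U hU
    obtain ⟨d, -, h1, h2⟩ := (P ⟨w, hw⟩).exists_boundary_dart (U : Set V) hw (hz _)
    exact h2 (hcl _ _ d.adj h1)
  by_contra hcon
  rw [SimpleGraph.connected_iff, not_and_or] at hcon
  rcases hcon with hcon | hcon
  · simp only [SimpleGraph.Preconnected, not_forall] at hcon
    obtain ⟨u, v, huv⟩ := hcon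
    let U : Finset V := Finset.univ.filter fun w => G.Reachable u w
    have hcard : U.card + Uᶜ.card = Fintype.card V := Finset.card_add_card_compl U
    rcases (by omega : U.card ≤ k ∨ Uᶜ.card ≤ k) with h1 | h1
    · refine key U ⟨u, by simp [U]⟩ h1 fun a b hab ha => ?_
      simp only [U, Finset.mem_filter, Finset.mem_univ, true_and] at ha ⊢
      exact ha.trans hab.reachable
    · refine key Uᶜ ⟨v, by simpa [U] using huv⟩ h1 fun a b hab ha => ?_
      simp only [U, Finset.mem_compl, Finset.mem_filter, Finset.mem_univ, true_and] at ha ⊢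
      exact fun hb => ha (hb.trans hab.symm.reachable)
  · exact hcon inferInstance

/-- A `c`-degenerate graph has at most `c * |U|` edges inside a set `U` of vertices: charge every
edge to the end that comes first in the ordering. -/
theorem IsDegenerate.card_edges_le {V : Type*} [Fintype V] {G : SimpleGraph V} {c : ℕ}
    (h : IsDegenerate c G) (U : Finset V) (E : Finset (Sym2 V)) (hE : ∀ e ∈ E, e ∈ G.edgeSet)
    (hEU : ∀ e ∈ E, ∀ v ∈ e, v ∈ U) : E.card ≤ c * U.card := by
  classical
  obtain ⟨v, hv⟩ := h
  let later : V → Finset V := fun u =>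
    (Finset.univ.filter fun j => v.symm u < j ∧ G.Adj u (v j)).image v
  have hlater : ∀ u, (later u).card ≤ c := fun u => by
    refine Finset.card_image_le.trans ((le_of_eq ?_).trans (hv (v.symm u)))
    rw [← Set.ncard_coe_finset]
    congr 1
    ext j
    simp
  have hsub : E ⊆ U.biUnion fun u => (later u).image fun w => s(u, w) := by
    intro e he
    induction e with
    | h p q =>
      have hadj : G.Adj p q := hE _ he
      have hp : p ∈ U := hEU _ he p (by simp)
      have hq : q ∈ U := hEU _ he q (by simp)
      have hne : v.symm p ≠ v.symm q := fun hh => hadj.ne (v.symm.injective hh)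
      simp only [Finset.mem_biUnion, Finset.mem_image]
      rcases lt_or_gt_of_ne hne with hlt | hlt
      · exact ⟨p, hp, q, by
          simp only [later, Finset.mem_image, Finset.mem_filter, Finset.mem_univ, true_and]
          exact ⟨v.symm q, ⟨hlt, by simpa using hadj⟩, by simp⟩, rfl⟩
      · exact ⟨q, hq, p, by
          simp only [later, Finset.mem_image, Finset.mem_filter, Finset.mem_univ, true_and]
          exact ⟨v.symm p, ⟨hlt, by simpa using hadj.symm⟩, by simp⟩, Sym2.eq_swap⟩
  calc E.card ≤ _ := Finset.card_le_card hsub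
    _ ≤ U.card * c := Finset.card_biUnion_le_card_mul _ _ _ fun u _ =>
        Finset.card_image_le.trans (hlater u)
    _ = c * U.card := mul_comm _ _

/-! ### Growth of balls -/

/-- The set of vertices at distance at most `j` from `x`. -/
noncomputable def closedBall {V : Type*} [Fintype V] (G : SimpleGraph V) (x : V) (j : ℕ) :
    Finset V :=
  open Classical in Finset.univ.filter fun w => G.dist x w ≤ j

theorem mem_closedBall {V : Type*} [Fintype V] {G : SimpleGraph V} {x w : V} {j : ℕ} :
    w ∈ closedBall G x j ↔ G.dist x w ≤ j := by
  simp [closedBall]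

theorem closedBall_mono {V : Type*} [Fintype V] (G : SimpleGraph V) (x : V) {i j : ℕ}
    (h : i ≤ j) : closedBall G x i ⊆ closedBall G x j := fun _ hw =>
  mem_closedBall.2 ((mem_closedBall.1 hw).trans h)

/-- Every ball of radius `j < t` needs as many edges leaving it as it has vertices. Edges leaving
balls of different radii are different, and all of them lie inside the ball of radius `t`, which
is sparse. -/
theorem sum_card_closedBall_le {V : Type*} [Fintype V] {G : SimpleGraph V} {c k t : ℕ}
    (hconn : G.Connected) (hdeg : IsDegenerate c G) (hpair : IsKPathPairable G k) (x : V)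
    (ht : (closedBall G x t).card ≤ k) :
    ∑ j ∈ Finset.range t, (closedBall G x j).card ≤ c * (closedBall G x t).card := by
  classical
  have hcross : ∀ j < t, ∃ f : closedBall G x j → Sym2 V, Function.Injective f ∧
      ∀ w, f w ∈ G.edgeSet ∧ ∃ p q, f w = s(p, q) ∧ G.dist x p = j ∧ G.dist x q = j + 1 := by
    intro j hj
    obtain ⟨z, P, hz, hP⟩ := hpair.exists_walks_leaving (closedBall G x j)
      ((Finset.card_le_card (closedBall_mono G x hj.le)).trans ht)
    have hd : ∀ w : closedBall G x j, ∃ d ∈ (P w).darts,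
        d.fst ∈ (closedBall G x j : Set V) ∧ d.snd ∉ (closedBall G x j : Set V) := fun w =>
      (P w).exists_boundary_dart _ w.2 (hz w)
    choose d hdP hd1 hd2 using hd
    have hmem : ∀ w, (d w).edge ∈ (P w).edges := fun w => List.mem_map_of_mem (hdP w)
    refine ⟨fun w => (d w).edge, fun w w' hww' => ?_, fun w => ⟨(d w).edge_mem, _, _, rfl, ?_⟩⟩
    · by_contra hne
      exact hP w w' hne (hmem w) (by rw [show (d w).edge = (d w').edge from hww']; exact hmem w')
    · have h1 := hd1 w
      have h2 := hd2 w
      simp only [Finset.mem_coe, mem_closedBall] at h1 h2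
      have h3 := hconn.dist_triangle (u := x) (v := (d w).fst) (w := (d w).snd)
      rw [SimpleGraph.dist_eq_one_iff_adj.2 (d w).adj] at h3
      omega
  choose f hfinj hf using hcross
  let E : ℕ → Finset (Sym2 V) := fun j =>
    if hj : j < t then Finset.univ.image (f j hj) else ∅
  have hEmem : ∀ j < t, ∀ e ∈ E j, e ∈ G.edgeSet ∧
      ∃ p q, e = s(p, q) ∧ G.dist x p = j ∧ G.dist x q = j + 1 := by
    intro j hj e he
    simp only [E, hj, dif_pos, Finset.mem_image] at he
    obtain ⟨w, -, rfl⟩ := he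
    exact hf j hj w
  have hEcard : ∀ j < t, (E j).card = (closedBall G x j).card := by
    intro j hj
    simp only [E, hj, dif_pos]
    rw [Finset.card_image_of_injective _ (hfinj j hj)]
    simp
  have hdisj : ∀ i ∈ Finset.range t, ∀ j ∈ Finset.range t, i ≠ j → Disjoint (E i) (E j) := by
    intro i hi j hj hij
    rw [Finset.disjoint_left]
    intro e he he'
    obtain ⟨-, p, q, rfl, hp, hq⟩ := hEmem i (Finset.mem_range.1 hi) e he
    obtain ⟨-, p', q', hpq, hp', hq'⟩ := hEmem j (Finset.mem_range.1 hj) _ he'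
    rw [Sym2.eq_iff] at hpq
    rcases hpq with ⟨rfl, rfl⟩ | ⟨rfl, rfl⟩ <;> omega
  calc ∑ j ∈ Finset.range t, (closedBall G x j).card
      = ∑ j ∈ Finset.range t, (E j).card :=
        Finset.sum_congr rfl fun j hj => (hEcard j (Finset.mem_range.1 hj)).symm
    _ = ((Finset.range t).biUnion E).card := (Finset.card_biUnion hdisj).symm
    _ ≤ _ := by
      apply hdeg.card_edges_le
      · intro e he
        obtain ⟨j, hj, he⟩ := Finset.mem_biUnion.1 he
        exact (hEmem j (Finset.mem_range.1 hj) e he).1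
      · intro e he v hv
        obtain ⟨j, hj, he⟩ := Finset.mem_biUnion.1 he
        have hj := Finset.mem_range.1 hj
        obtain ⟨-, p, q, rfl, hp, hq⟩ := hEmem j hj e he
        rw [mem_closedBall]
        rcases Sym2.mem_iff.1 hv with rfl | rfl <;> omega

theorem pow_le_of_card_closedBall_le {V : Type*} [Fintype V] {G : SimpleGraph V} {c k t : ℕ}
    (hc : 0 < c) (hconn : G.Connected) (hdeg : IsDegenerate c G) (hpair : IsKPathPairable G k)
    (x : V) (ht : (closedBall G x t).card ≤ k) :
    (1 + 1 / (c : ℝ)) ^ t ≤ (c + 1) * Fintype.card V := by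
  have hc' : (0 : ℝ) < c := by exact_mod_cast hc
  have hpow : ∀ s ≤ t, (1 + 1 / (c : ℝ)) ^ s ≤
      ∑ j ∈ Finset.range (s + 1), ((closedBall G x j).card : ℝ) := by
    intro s
    induction s with
    | zero =>
      intro _
      have : 0 < (closedBall G x 0).card := Finset.card_pos.2 ⟨x, by simp [mem_closedBall]⟩
      simpa using this
    | succ s ih =>
      intro hs
      rw [Finset.sum_range_succ, pow_succ]
      have h1 := sum_card_closedBall_le hconn hdeg hpair x (t := s + 1)
        ((Finset.card_le_card (closedBall_mono G x hs)).trans ht)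
      have h2 : (∑ j ∈ Finset.range (s + 1), ((closedBall G x j).card : ℝ)) ≤
          c * (closedBall G x (s + 1)).card := by exact_mod_cast h1
      have h3 := ih (by omega)
      have h4 : (∑ j ∈ Finset.range (s + 1), ((closedBall G x j).card : ℝ)) * (1 / (c : ℝ)) ≤
          (closedBall G x (s + 1)).card := by
        rw [mul_one_div, div_le_iff₀ hc']
        linarith
      calc _ ≤ (∑ j ∈ Finset.range (s + 1), ((closedBall G x j).card : ℝ)) *
            (1 + 1 / (c : ℝ)) := by gcongr
        _ ≤ _ := by linarith
  have h1 : (∑ j ∈ Finset.range t, ((closedBall G x j).card : ℝ)) ≤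
      c * (closedBall G x t).card := by
    exact_mod_cast sum_card_closedBall_le hconn hdeg hpair x ht
  have h2 : ((closedBall G x t).card : ℝ) ≤ Fintype.card V := by
    exact_mod_cast Finset.card_le_univ _
  have h3 := hpow t le_rfl
  rw [Finset.sum_range_succ] at h3
  nlinarith

/-- One of two disjoint balls of equal radius holds at most half of the vertices, so the radius is
logarithmic in the number of vertices. -/
theorem exists_pow_le_of_ediam_eq {V : Type*} [Fintype V] [Nonempty V] {G : SimpleGraph V} {c d : ℕ}
    (hc : 0 < c) (hdeg : IsDegenerate c G) (hpair : IsPathPairable G) (hd : G.ediam = d) :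
    ∃ t : ℕ, d ≤ 2 * t + 2 ∧ (1 + 1 / (c : ℝ)) ^ t ≤ (c + 1) * Fintype.card V := by
  classical
  have hconn := hpair.connected
  obtain ⟨k, hk, hpair⟩ := hpair
  rcases Nat.eq_zero_or_pos d with rfl | hdpos
  · refine ⟨0, by omega, ?_⟩
    have h1 : (1 : ℝ) ≤ Fintype.card V := by exact_mod_cast Fintype.card_pos (α := V)
    have h2 : (0 : ℝ) ≤ c := by positivity
    rw [pow_zero]
    nlinarith
  obtain ⟨x, y, hxy⟩ := SimpleGraph.exists_edist_eq_ediam_of_finite (G := G)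
  rw [hd, ← (hconn.preconnected x y).coe_dist_eq_edist] at hxy
  have hxy : G.dist x y = d := by exact_mod_cast hxy
  refine ⟨(d - 1) / 2, by omega, ?_⟩
  have hdisj : Disjoint (closedBall G x ((d - 1) / 2)) (closedBall G y ((d - 1) / 2)) := by
    rw [Finset.disjoint_left]
    intro w hw hw'
    rw [mem_closedBall] at hw hw'
    have := hconn.dist_triangle (u := x) (v := w) (w := y)
    rw [G.dist_comm (u := w)] at this
    omega
  have hcard := Finset.card_le_univ
    (closedBall G x ((d - 1) / 2) ∪ closedBall G y ((d - 1) / 2))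
  rw [Finset.card_union_of_disjoint hdisj] at hcard
  rcases (by omega : (closedBall G x ((d - 1) / 2)).card ≤ k ∨
    (closedBall G y ((d - 1) / 2)).card ≤ k) with h | h
  · exact pow_le_of_card_closedBall_le hc hconn hdeg hpair x h
  · exact pow_le_of_card_closedBall_le hc hconn hdeg hpair y h

/-! ### Stars, and existence of the maximum diameter -/

/-- An ordering witnessing degeneracy is obtained by sorting the vertices by any rank for which
few neighbours have the same or a higher rank. -/
theorem isDegenerate_of_rank {V : Type*} [Fintype V] {G : SimpleGraph V} {c : ℕ} (ρ : V → ℕ)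
    (h : ∀ u, Set.ncard {w | G.Adj u w ∧ ρ u ≤ ρ w} ≤ c) : IsDegenerate c G := by
  let e := (Fintype.equivFin V).symm
  let σ := Tuple.sort (ρ ∘ e)
  have hmono : Monotone ((ρ ∘ e) ∘ σ) := Tuple.monotone_sort _
  refine ⟨σ.trans e, fun i => le_trans ?_ (h ((σ.trans e) i))⟩
  refine Set.ncard_le_ncard_of_injOn (σ.trans e) ?_ (σ.trans e).injective.injOn (Set.toFinite _)
  rintro j ⟨hij, hadj⟩
  exact ⟨hadj, hmono hij.le⟩

/-- The star with centre `z`. -/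
def star {V : Type*} (z : V) : SimpleGraph V :=
  SimpleGraph.fromRel fun _ w => w = z

theorem isPathPairable_star {V : Type*} [Fintype V] (z : V) : IsPathPairable (star z) := by
  classical
  have hadj : ∀ v, v ≠ z → (star z).Adj v z := fun v hv => by simp [star, hv]
  have hW : ∀ v, ∃ W : (star z).Walk v z, ∀ e ∈ W.edges, e = s(v, z) := by
    intro v
    by_cases hv : v = z
    · subst hv
      exact ⟨.nil, by simp⟩
    · exact ⟨.cons (hadj v hv) .nil, by simp⟩
  choose W hW using hW
  refine ⟨Fintype.card V / 2, by omega, isKPathPairable_of_walks (by omega) fun x y hx hy hxy =>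
    ⟨fun i => (W (x i)).append (W (y i)).reverse, fun i j hij e he he' => ?_⟩⟩
  have hmem : ∀ i, e ∈ ((W (x i)).append (W (y i)).reverse).edges →
      e = s(x i, z) ∨ e = s(y i, z) := by
    intro i he
    rw [SimpleGraph.Walk.edges_append, SimpleGraph.Walk.edges_reverse, List.mem_append,
      List.mem_reverse] at he
    exact he.imp (hW _ e) (hW _ e)
  have hne : ∀ i j, x i ≠ y j := fun i j h =>
    Set.disjoint_left.1 hxy ⟨i, rfl⟩ ⟨j, h.symm⟩
  rcases hmem i he with rfl | rfl <;> rcases hmem j he' with h | h <;>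
    rw [Sym2.congr_left] at h
  · exact hij (hx h)
  · exact hne _ _ h
  · exact hne _ _ h.symm
  · exact hij (hy h)

theorem isDegenerate_star {V : Type*} [Fintype V] {c : ℕ} (hc : 0 < c) (z : V) :
    IsDegenerate c (star z) := by
  classical
  refine isDegenerate_of_rank (fun v => if v = z then 1 else 0) fun u => ?_
  refine le_trans (Set.ncard_le_ncard (t := {z}) ?_) (by simpa using Nat.succ_le_of_lt hc)
  rintro w ⟨hw, hle⟩
  simp only [star, SimpleGraph.fromRel_adj] at hw
  by_contra hwz
  have hu : u = z := by simpa [show w ≠ z from hwz] using hw.2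
  simp [hu, show w ≠ z from hwz] at hle

theorem isGreatest_maxDiam {c n : ℕ} (hc : 0 < c) (hn : 1 ≤ n) :
    IsGreatest (diameters n (degenerateFamily c)) (maxDiam n (degenerateFamily c) : ℕ∞) := by
  have : Nonempty (Fin n) := ⟨⟨0, hn⟩⟩
  have hfin : (diameters n (degenerateFamily c)).Finite :=
    (Set.toFinite (Set.range fun G : SimpleGraph (Fin n) => G.ediam)).subset <| by
      rintro _ ⟨G, -, -, rfl⟩
      exact ⟨G, rfl⟩
  have hne : (diameters n (degenerateFamily c)).Nonempty :=
    ⟨_, star ⟨0, hn⟩, isDegenerate_star hc _, isPathPairable_star _, rfl⟩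
  have hmem := hne.csSup_mem hfin
  have htop : sSup (diameters n (degenerateFamily c)) ≠ ⊤ := by
    obtain ⟨G, -, hG, hD⟩ := hmem
    rw [← hD]
    exact SimpleGraph.connected_iff_ediam_ne_top.1 hG.connected
  rw [maxDiam, ENat.natCast_toNat htop]
  exact ⟨hmem, fun D hD => le_sSup hD⟩

/-! ### Linking via hubs -/

/-- Greedy list colouring: colours `col i ∈ H \ F i` can be chosen with conflicting indices
coloured differently, if every index has more colours than forbidden ones and conflicts. -/
theorem exists_greedy_colouring {ι κ : Type*} [Fintype ι] [DecidableEq ι] [DecidableEq κ]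
    (H : Finset κ) (F : ι → Finset κ) (conf : ι → ι → Prop) [DecidableRel conf]
    (hsymm : ∀ i j, conf i j → conf j i)
    (h : ∀ i, (F i).card + (Finset.univ.filter fun j => j ≠ i ∧ conf i j).card < H.card) :
    ∃ col : ι → κ, ∀ i, col i ∈ H ∧ col i ∉ F i ∧ ∀ j, j ≠ i → conf i j → col i ≠ col j := by
  suffices hs : ∀ s : Finset ι, ∃ col : ι → κ, ∀ i ∈ s, col i ∈ H ∧ col i ∉ F i ∧
      ∀ j ∈ s, j ≠ i → conf i j → col i ≠ col j by
    obtain ⟨col, hcol⟩ := hs Finset.univ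
    exact ⟨col, fun i => ⟨(hcol i (by simp)).1, (hcol i (by simp)).2.1,
      fun j => (hcol i (by simp)).2.2 j (by simp)⟩⟩
  intro s
  induction s using Finset.induction_on with
  | empty =>
    by_cases hι : Nonempty ι
    · obtain ⟨i⟩ := hι
      obtain ⟨c, -⟩ := Finset.card_pos.1 (Nat.zero_lt_of_lt (h i))
      exact ⟨fun _ => c, by simp⟩
    · exact ⟨fun i => (hι ⟨i⟩).elim, by simp⟩
  | insert i s hi ih =>
    obtain ⟨col, hcol⟩ := ih
    obtain ⟨c, hcH, hc⟩ := Finset.exists_mem_notMem_of_card_lt_card (lt_of_le_of_lt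
      ((Finset.card_union_le (F i)
        ((Finset.univ.filter fun j => j ≠ i ∧ conf i j).image col)).trans
        (Nat.add_le_add_left Finset.card_image_le _)) (h i))
    rw [Finset.mem_union, not_or] at hc
    obtain ⟨hcF, hc⟩ := hc
    have hc : ∀ j, j ≠ i → conf i j → col j ≠ c := fun j hj hij hcj =>
      hc (Finset.mem_image.2 ⟨j, by simp [hj, hij], hcj⟩)
    refine ⟨Function.update col i c, fun j hj => ?_⟩
    by_cases hji : j = i
    · subst hji
      rw [Function.update_self]
      refine ⟨hcH, hcF, fun l _ hl hjl => ?_⟩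
      rw [Function.update_of_ne hl]
      exact (hc l hl hjl).symm
    · rw [Function.update_of_ne hji]
      have hjs : j ∈ s := Finset.mem_of_mem_insert_of_ne hj hji
      refine ⟨(hcol j hjs).1, (hcol j hjs).2.1, fun l hl hlj hjl => ?_⟩
      by_cases hli : l = i
      · subst hli
        rw [Function.update_self]
        exact hc j hji (hsymm _ _ hjl)
      · rw [Function.update_of_ne hli]
        exact (hcol j hjs).2.2 l (Finset.mem_of_mem_insert_of_ne hl hli) hlj hjl

/-- Suppose edge-disjoint walks `W v` bring all vertices `v` to vertices `t v` that are joined to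
every vertex of a set `H` of hubs. At most `a` of the walks end at the same vertex, counting in the
edges from there to `H` which the walks have used up (`F` collects their ends). If there are at
least `2a - 1` hubs, then every pairing of the vertices is linked: the walks of a pair are joined
via a hub, and hubs are assigned to the pairs greedily. -/
theorem isKPathPairable_of_hubs {V : Type*} [Fintype V] [DecidableEq V] {G : SimpleGraph V}
    {k a : ℕ} (H : Finset V) (t : V → V) (W : ∀ v, G.Walk v (t v)) (F : V → Finset V)
    (hH : 2 * a ≤ H.card + 1) (htH : ∀ v, t v ∉ H) (hadj : ∀ v, ∀ h ∈ H, G.Adj (t v) h)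
    (hW : ∀ v w, v ≠ w → List.Disjoint (W v).edges (W w).edges)
    (hF : ∀ v p, ∀ h ∈ H, s(t p, h) ∈ (W v).edges → h ∈ F (t p))
    (hload : ∀ v, (Finset.univ.filter fun w => t w = t v).card + (F (t v)).card ≤ a)
    (hk : 2 * k ≤ Fintype.card V) : IsKPathPairable G k := by
  refine isKPathPairable_of_walks hk fun x y hx hy hxy => ?_
  have hne : ∀ i j, x i ≠ y j := fun i j h =>
    Set.disjoint_left.1 hxy ⟨i, rfl⟩ ⟨j, h.symm⟩
  -- the pairs other than `i` that have an end at `t v`, where `v` is an end of the pair `i`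
  have hcount : ∀ i v, (∀ j, j ≠ i → x j ≠ v ∧ y j ≠ v) →
      (Finset.univ.filter fun j => j ≠ i ∧ (t (x j) = t v ∨ t (y j) = t v)).card + 1 ≤
        (Finset.univ.filter fun w => t w = t v).card := by
    intro i v hv
    rw [← Finset.card_erase_add_one (a := v) (s := Finset.univ.filter fun w => t w = t v)
      (by simp)]
    refine Nat.add_le_add_right (Finset.card_le_card_of_injOn
      (fun j => if t (x j) = t v then x j else y j) ?_ ?_) 1
    · intro j hj
      simp only [Finset.coe_filter, Finset.mem_univ, true_and, Set.mem_ofPred_eq] at hj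
      obtain ⟨hji, hj⟩ := hj
      simp only [Finset.coe_erase, Finset.coe_filter, Finset.mem_univ, true_and]
      split_ifs with hxj
      · exact ⟨hxj, (hv j hji).1⟩
      · exact ⟨hj.resolve_left hxj, (hv j hji).2⟩
    · intro j _ l _ hjl
      simp only at hjl
      split_ifs at hjl
      · exact hx hjl
      · exact absurd hjl (hne _ _)
      · exact absurd hjl.symm (hne _ _)
      · exact hy hjl
  let conf : Fin k → Fin k → Prop := fun i j =>
    (t (x j) = t (x i) ∨ t (y j) = t (x i)) ∨ (t (x j) = t (y i) ∨ t (y j) = t (y i))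
  have hcol := exists_greedy_colouring H (fun i => F (t (x i)) ∪ F (t (y i))) conf
    (by
      rintro i j ((h | h) | (h | h))
      · exact Or.inl (Or.inl h.symm)
      · exact Or.inr (Or.inl h.symm)
      · exact Or.inl (Or.inr h.symm)
      · exact Or.inr (Or.inr h.symm))
    (by
      intro i
      have h1 := hcount i (x i) fun j hj => ⟨fun h => hj (hx h), (hne _ _).symm⟩
      have h2 := hcount i (y i) fun j hj => ⟨hne _ _, fun h => hj (hy h)⟩
      have h3 : (Finset.univ.filter fun j => j ≠ i ∧ conf i j).card ≤ _ :=
        (Finset.card_le_card (t :=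
          (Finset.univ.filter fun j => j ≠ i ∧ (t (x j) = t (x i) ∨ t (y j) = t (x i))) ∪
          (Finset.univ.filter fun j => j ≠ i ∧ (t (x j) = t (y i) ∨ t (y j) = t (y i))))
          (by
            intro j hj
            simp only [conf, Finset.mem_union, Finset.mem_filter, Finset.mem_univ,
              true_and] at hj ⊢
            exact hj.2.imp (fun h => ⟨hj.1, h⟩) fun h => ⟨hj.1, h⟩)).trans
          (Finset.card_union_le _ _)
      have h4 := Finset.card_union_le (F (t (x i))) (F (t (y i)))
      have h5 := hload (x i)
      have h6 := hload (y i)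
      omega)
  obtain ⟨col, hcol⟩ := hcol
  refine ⟨fun i => (W (x i)).append (.cons (hadj (x i) (col i) (hcol i).1)
    (.cons (hadj (y i) (col i) (hcol i).1).symm (W (y i)).reverse)), fun i j hij e he he' => ?_⟩
  have hmem : ∀ i, e ∈ ((W (x i)).append (.cons (hadj (x i) (col i) (hcol i).1)
      (.cons (hadj (y i) (col i) (hcol i).1).symm (W (y i)).reverse))).edges →
      (∃ v, (v = x i ∨ v = y i) ∧ e ∈ (W v).edges) ∨
        ∃ v, (v = x i ∨ v = y i) ∧ e = s(t v, col i) := by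
    intro i he
    simp only [SimpleGraph.Walk.edges_append, SimpleGraph.Walk.edges_cons,
      SimpleGraph.Walk.edges_reverse, List.mem_append, List.mem_cons, List.mem_reverse] at he
    rcases he with he | rfl | rfl | he
    · exact Or.inl ⟨_, Or.inl rfl, he⟩
    · exact Or.inr ⟨_, Or.inl rfl, rfl⟩
    · exact Or.inr ⟨_, Or.inr rfl, Sym2.eq_swap⟩
    · exact Or.inl ⟨_, Or.inr rfl, he⟩
  -- a walk `W v` uses no edge to a hub that is permitted for a pair
  have hmixed : ∀ i v w, (v = x i ∨ v = y i) → s(t v, col i) ∉ (W w).edges := by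
    intro i v w hv he
    have hcF := (hcol i).2.1
    rw [Finset.mem_union, not_or] at hcF
    have := hF w v (col i) (hcol i).1 he
    rcases hv with rfl | rfl
    · exact hcF.1 this
    · exact hcF.2 this
  rcases hmem i he with ⟨v, hv, h⟩ | ⟨v, hv, rfl⟩ <;>
    rcases hmem j he' with ⟨w, hw, h'⟩ | ⟨w, hw, h'⟩
  · refine hW v w ?_ h h'
    rintro rfl
    rcases hv with rfl | rfl <;> rcases hw with hw | hw
    · exact hij (hx hw)
    · exact hne _ _ hw
    · exact hne _ _ hw.symm
    · exact hij (hy hw)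
  · subst h'
    exact hmixed j w v hw h
  · exact hmixed i v w hv h'
  · rw [Sym2.eq_iff] at h'
    rcases h' with ⟨h1, h2⟩ | ⟨h1, -⟩
    · refine (hcol i).2.2 j hij.symm ?_ h2
      rcases hv with rfl | rfl <;> rcases hw with rfl | rfl
      · exact Or.inl (Or.inl h1.symm)
      · exact Or.inl (Or.inr h1.symm)
      · exact Or.inr (Or.inl h1.symm)
      · exact Or.inr (Or.inr h1.symm)
    · exact htH v (h1 ▸ (hcol j).1)

/-! ### Diameter bounds and isomorphisms -/

/-- A function that changes by at most one along every edge bounds the diameter from below. -/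
theorem natAbs_sub_le_ediam {V : Type*} {G : SimpleGraph V} (φ : V → ℤ)
    (hφ : ∀ v w, G.Adj v w → (φ v - φ w).natAbs ≤ 1) (u v : V) :
    ((φ u - φ v).natAbs : ℕ∞) ≤ G.ediam := by
  have hwalk : ∀ u v, ∀ p : G.Walk u v, (φ u - φ v).natAbs ≤ p.length := by
    intro u v p
    induction p with
    | nil => simp
    | cons h p ih =>
      have := hφ _ _ h
      rw [SimpleGraph.Walk.length_cons]
      omega
  refine le_trans ?_ (SimpleGraph.edist_le_ediam (u := u) (v := v))
  by_cases htop : G.edist u v = ⊤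
  · simp [htop]
  · obtain ⟨p, hp⟩ := SimpleGraph.exists_walk_of_edist_ne_top htop
    rw [← hp]
    exact_mod_cast hwalk u v p

theorem IsKPathPairable.of_iso {V V' : Type*} [Fintype V] [Fintype V'] {G : SimpleGraph V}
    {G' : SimpleGraph V'} {k : ℕ} (φ : G ≃g G') (h : IsKPathPairable G k) :
    IsKPathPairable G' k := by
  refine isKPathPairable_of_walks (by rw [← Fintype.card_congr φ.toEquiv]; exact h.1)
    fun x y hx hy hxy => ?_
  obtain ⟨P, -, hP⟩ := h.2 (fun i => φ.symm (x i)) (fun i => φ.symm (y i))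
    (fun i j hij => hx (φ.symm.injective hij)) (fun i j hij => hy (φ.symm.injective hij))
    (by
      rw [Set.disjoint_left] at hxy ⊢
      rintro _ ⟨i, rfl⟩ ⟨j, hj⟩
      exact hxy ⟨i, rfl⟩ ⟨j, φ.symm.injective hj⟩)
  refine ⟨fun i => ((P i).map φ.toHom).copy (by simp) (by simp), fun i j hij e he he' => ?_⟩
  simp only [SimpleGraph.Walk.edges_copy, SimpleGraph.Walk.edges_map, List.mem_map] at he he'
  obtain ⟨e₁, h₁, rfl⟩ := he
  obtain ⟨e₂, h₂, h₁₂⟩ := he'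
  have : e₂ = e₁ := Sym2.map.injective φ.injective h₁₂
  exact hP i j hij h₁ (this ▸ h₂)

theorem IsDegenerate.of_iso {V V' : Type*} [Fintype V] [Fintype V'] {G : SimpleGraph V}
    {G' : SimpleGraph V'} {c : ℕ} (φ : G ≃g G') (h : IsDegenerate c G) : IsDegenerate c G' := by
  obtain ⟨v, hv⟩ := h
  have hcard : Fintype.card V' = Fintype.card V := (Fintype.card_congr φ.toEquiv).symm
  refine ⟨(finCongr hcard).trans (v.trans φ.toEquiv), fun i => ?_⟩
  refine le_trans ?_ (hv (finCongr hcard i))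
  refine Set.ncard_le_ncard_of_injOn (finCongr hcard) ?_ (finCongr hcard).injective.injOn
    (Set.toFinite _)
  rintro j ⟨hij, hadj⟩
  exact ⟨hij, φ.map_adj_iff.1 hadj⟩

theorem ediam_le_of_iso {V V' : Type*} {G : SimpleGraph V} {G' : SimpleGraph V'} (φ : G ≃g G') :
    G.ediam ≤ G'.ediam := by
  refine SimpleGraph.ediam_le_of_edist_le fun u v => ?_
  by_cases htop : G'.edist (φ u) (φ v) = ⊤
  · exact le_top.trans (htop ▸ SimpleGraph.edist_le_ediam)
  · obtain ⟨p, hp⟩ := SimpleGraph.exists_walk_of_edist_ne_top htop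
    refine le_trans ?_ (hp.le.trans SimpleGraph.edist_le_ediam)
    have := SimpleGraph.edist_le ((p.map φ.symm.toHom).copy (u' := u) (v' := v)
      (by simp) (by simp))
    simpa using this

/-! ### Layers and tokens -/

/-- The sizes of the layers, `b` and then `s ↦ ⌈(b + 1) * s / b⌉`: if each vertex of a layer passes
on `b + 1` tokens, then the next layer can take them with `b` tokens per vertex. -/
def layerSize (b : ℕ) : ℕ → ℕ
  | 0 => b
  | i + 1 => ((b + 1) * layerSize b i + (b - 1)) / b

theorem le_layerSize {b : ℕ} [NeZero b] (i : ℕ) : b ≤ layerSize b i := by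
  have hb : 0 < b := NeZero.pos b
  induction i with
  | zero => exact le_rfl
  | succ i ih =>
    rw [layerSize, Nat.le_div_iff_mul_le hb]
    nlinarith

theorem layerSize_add_le {b : ℕ} [NeZero b] (i : ℕ) :
    (layerSize b i : ℝ) + b ≤ 2 * b * (((b : ℝ) + 1) / b) ^ i := by
  have hb : 0 < b := NeZero.pos b
  have hb' : (0 : ℝ) < b := by exact_mod_cast hb
  induction i with
  | zero => simp [layerSize]; linarith
  | succ i ih =>
    have h1 : b * layerSize b (i + 1) ≤ (b + 1) * layerSize b i + (b - 1) :=
      Nat.mul_div_le _ _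
    have h2 : b * layerSize b (i + 1) ≤ (b + 1) * layerSize b i + b := by omega
    have h3 : (b : ℝ) * layerSize b (i + 1) ≤ (b + 1) * layerSize b i + b := by exact_mod_cast h2
    rw [pow_succ, ← mul_assoc, mul_div_assoc', le_div_iff₀ hb']
    nlinarith

/-- A token: it sits on the vertex `vertex` of the layer `level` in one of the two copies of the
layers, in one of `b + 1` slots. The token of slot `b` is the one that starts at the vertex, the
other slots are for tokens that come from the preceding layer. -/
@[ext]
structure Token (b : ℕ) where
  copy : Bool
  level : ℕ
  vertex : ℕ
  slot : ℕ
  vertex_lt : vertex < layerSize b level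
  slot_le : slot ≤ b

namespace Token

variable {b : ℕ} [NeZero b]

/-- The next position of a token. The tokens of a layer are numbered slot by slot, and the number
`e` goes to the vertex `e / b`, slot `e % b`. Since a layer has at least `b` vertices, different
slots of a vertex lead to different vertices. -/
def next (x : Token b) : Token b where
  copy := x.copy
  level := x.level + 1
  vertex := (x.slot * layerSize b x.level + x.vertex) / b
  slot := (x.slot * layerSize b x.level + x.vertex) % b
  vertex_lt := by
    have hb : 0 < b := NeZero.pos b
    have h1 := x.vertex_lt
    have h2 := Nat.mul_le_mul_right (layerSize b x.level) x.slot_le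
    rw [layerSize, Nat.lt_iff_add_one_le, Nat.le_div_iff_mul_le hb, add_mul]
    have h3 := Nat.div_mul_le_self (x.slot * layerSize b x.level + x.vertex) b
    rw [add_mul]
    omega
  slot_le := (Nat.mod_lt _ (NeZero.pos b)).le

theorem next_injective : Function.Injective (next (b := b)) := by
  intro x y h
  have hc : x.copy = y.copy := (congrArg copy h : x.next.copy = y.next.copy)
  have hl : x.level = y.level := Nat.succ_injective
    (congrArg level h : x.next.level = y.next.level)
  have hv : (x.slot * layerSize b x.level + x.vertex) / b =
      (y.slot * layerSize b y.level + y.vertex) / b :=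
    (congrArg vertex h : x.next.vertex = y.next.vertex)
  have hs : (x.slot * layerSize b x.level + x.vertex) % b =
      (y.slot * layerSize b y.level + y.vertex) % b :=
    (congrArg slot h : x.next.slot = y.next.slot)
  have he : x.slot * layerSize b x.level + x.vertex =
      y.slot * layerSize b y.level + y.vertex := by
    rw [← Nat.div_add_mod (x.slot * layerSize b x.level + x.vertex) b, hv, hs, Nat.div_add_mod]
  have hx := x.vertex_lt
  have hy := y.vertex_lt
  rw [← hl] at he hy
  have hpos : 0 < layerSize b x.level := by omega
  have h1 := congrArg (· / layerSize b x.level) he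
  have h2 := congrArg (· % layerSize b x.level) he
  simp only [mul_comm _ (layerSize b x.level), Nat.mul_add_div hpos, Nat.mul_add_mod,
    Nat.div_eq_of_lt hx, Nat.div_eq_of_lt hy, Nat.mod_eq_of_lt hx, Nat.mod_eq_of_lt hy,
    add_zero] at h1 h2
  exact Token.ext hc hl h2 h1

theorem slot_next_lt (x : Token b) : x.next.slot < b := Nat.mod_lt _ (NeZero.pos b)

theorem level_iterate_next (x : Token b) (p : ℕ) : (next^[p] x).level = x.level + p := by
  induction p with
  | zero => rfl
  | succ p ih =>
    rw [Function.iterate_succ_apply']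
    show (next^[p] x).level + 1 = _
    omega

theorem copy_iterate_next (x : Token b) (p : ℕ) : (next^[p] x).copy = x.copy := by
  induction p with
  | zero => rfl
  | succ p ih => rw [Function.iterate_succ_apply']; exact ih

/-- Tokens that start at different vertices never meet in the same slot. -/
theorem eq_of_iterate_next_eq {x y : Token b} (hx : x.slot = b) (hy : y.slot = b) {p q : ℕ}
    (h : next^[p] x = next^[q] y) : x = y := by
  wlog hpq : p ≤ q generalizing x y p q
  · exact (this hy hx h.symm (by omega)).symm
  obtain ⟨r, rfl⟩ := Nat.exists_eq_add_of_le hpq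
  rw [Function.iterate_add_apply] at h
  have h := (next_injective.iterate p) h
  cases r with
  | zero => exact h
  | succ r =>
    rw [Function.iterate_succ_apply'] at h
    have := slot_next_lt (next^[r] y)
    rw [← h] at this
    omega

/-- If two tokens move along the same edge, then they are in the same position. -/
theorem eq_of_vertex_next_eq {x y : Token b} (hc : x.copy = y.copy) (hl : x.level = y.level)
    (hv : x.vertex = y.vertex) (h : x.next.vertex = y.next.vertex) : x = y := by
  refine Token.ext hc hl hv ?_
  have hb : 0 < b := NeZero.pos b
  have h : (x.slot * layerSize b x.level + x.vertex) / b =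
      (y.slot * layerSize b y.level + y.vertex) / b := h
  rw [← hl, ← hv] at h
  have hs := le_layerSize (b := b) x.level
  -- positions of consecutive slots differ by at least `b`
  have key : ∀ i j : ℕ, i < j → (i * layerSize b x.level + x.vertex) / b <
      (j * layerSize b x.level + x.vertex) / b := by
    intro i j hij
    have h1 : (i * layerSize b x.level + x.vertex) + b ≤ j * layerSize b x.level + x.vertex := by
      have := Nat.mul_le_mul_right (layerSize b x.level) (Nat.succ_le_of_lt hij)
      rw [Nat.succ_mul] at this
      omega
    calc _ < (i * layerSize b x.level + x.vertex) / b + 1 := Nat.lt_succ_self _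
      _ = ((i * layerSize b x.level + x.vertex) + b) / b := (Nat.add_div_right _ hb).symm
      _ ≤ _ := Nat.div_le_div_right h1
  rcases lt_trichotomy x.slot y.slot with hlt | heq | hlt
  · exact absurd h (key _ _ hlt).ne
  · exact heq
  · exact absurd h (key _ _ hlt).ne'

end Token

/-! ### The layered graph -/

/-- The vertices of the graph: two copies of the layers `0, …, m`, then `f` filler vertices, then
`2b + 1` hubs. -/
abbrev Vertex (b m f : ℕ) : Type :=
  (Bool × (Σ i : Fin (m + 1), Fin (layerSize b i))) ⊕ (Fin f ⊕ Fin (2 * b + 1))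

theorem card_vertex (b m f : ℕ) : Fintype.card (Vertex b m f) =
    2 * ∑ i ∈ Finset.range (m + 1), layerSize b i + (f + (2 * b + 1)) := by
  simp [Vertex, Finset.sum_range]

namespace Vertex

variable {b m f : ℕ}

/-- The vertex `u` of the layer `i` in the given copy of the layers. -/
def layer (β : Bool) (i u : ℕ) (hi : i ≤ m) (hu : u < layerSize b i) : Vertex b m f :=
  .inl (β, ⟨⟨i, Nat.lt_succ_of_le hi⟩, ⟨u, hu⟩⟩)

/-- The filler vertices are joined to the hubs only. Some serve to carry the tokens of the hubs. -/
def filler (j : Fin f) : Vertex b m f := .inr (.inl j)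

/-- The hubs are joined to the last layers and to the filler vertices. -/
def hub (h : Fin (2 * b + 1)) : Vertex b m f := .inr (.inr h)

theorem layer_inj {β β' : Bool} {i i' u u' : ℕ} {hi : i ≤ m} {hi' : i' ≤ m}
    {hu : u < layerSize b i} {hu' : u' < layerSize b i'} :
    (layer β i u hi hu : Vertex b m f) = layer β' i' u' hi' hu' ↔ β = β' ∧ i = i' ∧ u = u' := by
  constructor
  · intro h
    simp only [layer, Sum.inl.injEq, Prod.mk.injEq, Sigma.mk.injEq, Fin.mk.injEq] at h
    obtain ⟨rfl, rfl, h⟩ := h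
    simpa using h
  · rintro ⟨rfl, rfl, rfl⟩
    rfl

theorem filler_injective : Function.Injective (filler : Fin f → Vertex b m f) := fun i j h => by
  simpa [filler] using h

theorem hub_injective : Function.Injective (hub : _ → Vertex b m f) := fun i j h => by
  simpa [hub] using h

theorem cases_vertex {P : Vertex b m f → Prop} (h1 : ∀ β i u hi hu, P (layer β i u hi hu))
    (h2 : ∀ j, P (filler j)) (h3 : ∀ h, P (hub h)) (v) : P v := by
  rcases v with ⟨β, ⟨i, hi⟩, ⟨u, hu⟩⟩ | j | h
  · exact h1 β i u (Nat.le_of_lt_succ hi) hu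
  · exact h2 j
  · exact h3 h

/-- The vertex on which a token sits; tokens beyond the layer `m` are sent to a hub as a dummy
value. -/
def pos (x : Token b) : Vertex b m f :=
  if h : x.level ≤ m then layer x.copy x.level x.vertex h x.vertex_lt else hub 0

theorem pos_eq {x : Token b} (h : x.level ≤ m) :
    (pos x : Vertex b m f) = layer x.copy x.level x.vertex h x.vertex_lt := by
  simp [pos, h]

/-- The rank that witnesses degeneracy. -/
def rank : Vertex b m f → ℕ
  | .inl (_, ⟨i, _⟩) => i
  | .inr (.inl _) => m
  | .inr (.inr _) => m + 1

/-- The signed distance from the hubs along the layers, with opposite signs in the two copies. -/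
def height : Vertex b m f → ℤ
  | .inl (β, ⟨i, _⟩) => (if β then 1 else -1) * ((m : ℤ) + 1 - (i : ℕ))
  | .inr _ => 0

@[simp] theorem rank_layer {β : Bool} {i u : ℕ} {hi : i ≤ m} {hu : u < layerSize b i} :
    rank (layer β i u hi hu : Vertex b m f) = i := rfl

@[simp] theorem rank_filler (j : Fin f) : rank (filler j : Vertex b m f) = m := rfl

@[simp] theorem rank_hub (h) : rank (hub h : Vertex b m f) = m + 1 := rfl

@[simp] theorem height_layer {β : Bool} {i u : ℕ} {hi : i ≤ m} {hu : u < layerSize b i} :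
    height (layer β i u hi hu : Vertex b m f) =
      (if β then 1 else -1) * ((m : ℤ) + 1 - (i : ℕ)) := rfl

@[simp] theorem height_filler (j : Fin f) : height (filler j : Vertex b m f) = 0 := rfl

@[simp] theorem height_hub (h) : height (hub h : Vertex b m f) = 0 := rfl

@[simp] theorem layer_ne_filler {β : Bool} {i u : ℕ} {hi : i ≤ m} {hu : u < layerSize b i}
    (j : Fin f) : (layer β i u hi hu : Vertex b m f) ≠ filler j := by simp [layer, filler]

@[simp] theorem layer_ne_hub {β : Bool} {i u : ℕ} {hi : i ≤ m} {hu : u < layerSize b i}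
    (h) : (layer β i u hi hu : Vertex b m f) ≠ hub h := by simp [layer, hub]

@[simp] theorem filler_ne_hub (j : Fin f) (h) : (filler j : Vertex b m f) ≠ hub h := by
  simp [filler, hub]

variable [NeZero b]

/-- The edges of the graph, oriented towards the hubs: the steps of the tokens from one layer to
the next one, and all edges from the last layers and the filler vertices to the hubs. -/
inductive Arc : Vertex b m f → Vertex b m f → Prop
  | step (x : Token b) (hx : x.level < m) : Arc (pos x) (pos x.next)
  | last (β : Bool) (u : ℕ) (hu : u < layerSize b m) (h : Fin (2 * b + 1)) :
      Arc (layer β m u le_rfl hu) (hub h)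
  | filler (j : Fin f) (h : Fin (2 * b + 1)) : Arc (filler j) (hub h)

theorem Arc.rank_lt {v w : Vertex b m f} (h : Arc v w) : rank v < rank w := by
  cases h with
  | step x hx =>
    rw [pos_eq hx.le, pos_eq (show x.next.level ≤ m from hx)]
    exact Nat.lt_succ_self _
  | last => simp
  | filler => simp

theorem Arc.natAbs_height_sub_le {v w : Vertex b m f} (h : Arc v w) :
    (height v - height w).natAbs ≤ 1 := by
  cases h with
  | step x hx =>
    rw [pos_eq hx.le, pos_eq (show x.next.level ≤ m from hx)]
    simp only [height_layer, Token.next]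
    split_ifs <;> push_cast <;> omega
  | last β u hu h => simp only [height_layer, height_hub]; split_ifs <;> omega
  | filler => simp

theorem ncard_le_of_subset_range {α : Type*} {n : ℕ} {s : Set α} {g : Fin n → α}
    (h : s ⊆ Set.range g) : s.ncard ≤ n := by
  refine (Set.ncard_le_ncard h (Set.finite_range g)).trans ?_
  rw [← Set.image_univ]
  exact (Set.ncard_image_le (Set.toFinite _)).trans (by simp [Set.ncard_univ])

theorem ncard_arc_le (v : Vertex b m f) : Set.ncard {w | Arc v w} ≤ 2 * b + 1 := by
  -- vertices of rank `m` or more are joined to hubs only, the others to `b + 1` vertices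
  by_cases hv : rank v < m
  · induction v using cases_vertex with
    | h1 β i u hi hu =>
      have hsub : {w : Vertex b m f | Arc (layer β i u hi hu) w} ⊆
          Set.range fun j : Fin (b + 1) =>
            pos (Token.next ⟨β, i, u, j, hu, Nat.le_of_lt_succ j.2⟩) := by
        intro w hw
        rw [Set.mem_ofPred_eq] at hw
        generalize hv' : (layer β i u hi hu : Vertex b m f) = v at hw
        cases hw with
        | step x hx =>
          rw [pos_eq hx.le, layer_inj] at hv'
          obtain ⟨h1, h2, h3⟩ := hv'
          exact ⟨⟨x.slot, Nat.lt_succ_of_le x.slot_le⟩,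
            congrArg (fun y => pos (Token.next y)) (Token.ext h1 h2 h3 rfl)⟩
        | last β' u' hu' h =>
          rw [layer_inj] at hv'
          rw [rank_layer] at hv
          omega
        | filler => simp at hv'
      have := ncard_le_of_subset_range hsub
      omega
    | h2 j => simp at hv
    | h3 h => simp at hv
  · have hsub : {w : Vertex b m f | Arc v w} ⊆ Set.range hub := by
      intro w hw
      cases hw with
      | step x hx =>
        rw [pos_eq hx.le] at hv
        exact absurd hx hv
      | last => exact ⟨_, rfl⟩
      | filler => exact ⟨_, rfl⟩
    exact ncard_le_of_subset_range hsub

end Vertex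

open Vertex

/-- The graph for the lower bound: two sequences of growing layers that meet in the hubs. -/
def layeredGraph (b m f : ℕ) [NeZero b] : SimpleGraph (Vertex b m f) := SimpleGraph.fromRel Arc

section LayeredGraph

variable {b m f : ℕ} [NeZero b]

theorem layeredGraph_adj {v w : Vertex b m f} :
    (layeredGraph b m f).Adj v w ↔ Arc v w ∨ Arc w v := by
  rw [layeredGraph, SimpleGraph.fromRel_adj, and_iff_right_iff_imp]
  rintro (h | h) rfl <;> exact absurd h.rank_lt (lt_irrefl _)

theorem isDegenerate_layeredGraph : IsDegenerate (2 * b + 1) (layeredGraph b m f) := by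
  refine isDegenerate_of_rank rank fun v => le_trans (Set.ncard_le_ncard ?_ (Set.toFinite _))
    (ncard_arc_le v)
  rintro w ⟨hadj, hrank⟩
  rcases layeredGraph_adj.1 hadj with h | h
  · exact h
  · exact absurd h.rank_lt (by omega)

theorem le_ediam_layeredGraph : ((2 * m + 2 : ℕ) : ℕ∞) ≤ (layeredGraph b m f).ediam := by
  have hb : 0 < layerSize b 0 := NeZero.pos b
  have h := natAbs_sub_le_ediam (G := layeredGraph b m f) height
    (fun v w h => by
      rcases layeredGraph_adj.1 h with h | h
      · exact h.natAbs_height_sub_le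
      · rw [← Int.natAbs_neg, neg_sub]
        exact h.natAbs_height_sub_le)
    (layer true 0 0 (Nat.zero_le _) hb) (layer false 0 0 (Nat.zero_le _) hb)
  refine le_trans (le_of_eq ?_) h
  congr 1
  simp only [height_layer]
  simp
  omega

/-- The walk of a token through `p` layers. -/
theorem exists_walk_token (p : ℕ) (x : Token b) (hx : x.level + p ≤ m) :
    ∃ W : (layeredGraph b m f).Walk (pos x) (pos (Token.next^[p] x)), ∀ e ∈ W.edges,
      ∃ q, x.level + q < m ∧
        e = s(pos (Token.next^[q] x), pos (Token.next (Token.next^[q] x))) := by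
  induction p generalizing x with
  | zero => exact ⟨.nil, by simp⟩
  | succ p ih =>
    have hlev : x.next.level = x.level + 1 := rfl
    obtain ⟨W, hW⟩ := ih x.next (by omega)
    refine ⟨.cons (layeredGraph_adj.2 (Or.inl (.step x (by omega)))) W, fun e he => ?_⟩
    have he : e = s(pos x, pos x.next) ∨ e ∈ W.edges := List.mem_cons.1 he
    rcases he with rfl | he
    · exact ⟨0, by omega, rfl⟩
    · obtain ⟨q, hq, rfl⟩ := hW e he
      exact ⟨q + 1, by omega, rfl⟩

/-- Every edge between layers is used by at most one token. -/
theorem token_eq_of_edge_eq {x y : Token b} (hx : x.level < m) (hy : y.level < m)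
    (h : s((pos x : Vertex b m f), pos x.next) = s(pos y, pos y.next)) : x = y := by
  have hx' : x.next.level ≤ m := hx
  have hy' : y.next.level ≤ m := hy
  have h1 : x.next.level = x.level + 1 := rfl
  have h2 : y.next.level = y.level + 1 := rfl
  rw [pos_eq hx.le, pos_eq hy.le, pos_eq hx', pos_eq hy', Sym2.eq_iff] at h
  simp only [layer_inj] at h
  rcases h with ⟨⟨hc, hl, hv⟩, -, -, hv'⟩ | ⟨⟨-, hl, -⟩, -, hl', -⟩
  · exact Token.eq_of_vertex_next_eq hc hl hv hv'
  · omega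

/-! ### Path-pairability of the layered graph -/

/-- The tokens of the layers move to the last layers, the fillers keep theirs, and each hub sends
its token to a filler of its own. At a last layer all `b + 1` slots may be taken; at a filler
there are at most two tokens and one used edge. -/
theorem isKPathPairable_layeredGraph {k : ℕ} (hb : 2 ≤ b) (hf : 2 * b + 1 ≤ f)
    (hk : 2 * k ≤ Fintype.card (Vertex b m f)) : IsKPathPairable (layeredGraph b m f) k := by
  classical
  have hspec : ∀ v : Vertex b m f, ∃ (t : Vertex b m f) (W : (layeredGraph b m f).Walk v t),
      (∃ x : Token b, x.slot = b ∧ x.level ≤ m ∧ v = pos x ∧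
        t = pos (Token.next^[m - x.level] x) ∧ ∀ e ∈ W.edges, ∃ q, x.level + q < m ∧
          e = s(pos (Token.next^[q] x), pos (Token.next (Token.next^[q] x)))) ∨
      (∃ j, v = filler j ∧ t = filler j ∧ W.edges = []) ∨
      ∃ h, v = hub h ∧ t = filler (h.castLE hf) ∧
        ∀ e ∈ W.edges, e = s(filler (h.castLE hf), hub h) := by
    intro v
    induction v using cases_vertex with
    | h1 β i u hi hu =>
      let x : Token b := ⟨β, i, u, b, hu, le_rfl⟩
      obtain ⟨W, hW⟩ := exists_walk_token (m := m) (f := f) (m - i) x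
        (show i + (m - i) ≤ m by omega)
      have hx : (pos x : Vertex b m f) = layer β i u hi hu := pos_eq hi
      exact ⟨_, W.copy hx rfl, Or.inl ⟨x, rfl, hi, hx.symm, rfl, by simpa using hW⟩⟩
    | h2 j => exact ⟨_, .nil, Or.inr (Or.inl ⟨j, rfl, rfl, rfl⟩)⟩
    | h3 h =>
      refine ⟨_, .cons (layeredGraph_adj.2 (Or.inr (.filler (h.castLE hf) h))) .nil,
        Or.inr (Or.inr ⟨h, rfl, rfl, ?_⟩)⟩
      simp [Sym2.eq_swap]
  choose t W hspec using hspec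
  -- the walk of a token ends in the last layer
  have hend : ∀ x : Token b, x.level ≤ m → ∃ hu : _ < layerSize b m,
      (pos (Token.next^[m - x.level] x) : Vertex b m f) =
        layer x.copy m (Token.next^[m - x.level] x).vertex le_rfl hu := by
    intro x hx
    have hlev : (Token.next^[m - x.level] x).level = m := by
      rw [Token.level_iterate_next]
      omega
    refine ⟨by simpa [hlev] using (Token.next^[m - x.level] x).vertex_lt, ?_⟩
    rw [pos_eq hlev.le, layer_inj]
    exact ⟨Token.copy_iterate_next _ _, hlev, rfl⟩
  have hstep : ∀ (x : Token b) (q : ℕ), x.level + q < m → (Token.next^[q] x).level < m := by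
    intro x q hq
    rw [Token.level_iterate_next]
    exact hq
  -- the edges of layers are not edges to hubs
  have hnohub : ∀ (x : Token b), x.level < m → ∀ (p : Vertex b m f) h,
      s(p, hub h) ≠ s(pos x, pos x.next) := by
    intro x hx p h he
    rw [pos_eq hx.le, pos_eq (show x.next.level ≤ m from hx), Sym2.eq_iff] at he
    rcases he with ⟨-, he⟩ | ⟨-, he⟩ <;> exact layer_ne_hub _ he.symm
  have ht : ∀ v h, t v ≠ hub h := by
    intro v h
    rcases hspec v with ⟨x, -, hx, -, ht, -⟩ | ⟨j, -, ht, -⟩ | ⟨h, -, ht, -⟩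
    · obtain ⟨hu, he⟩ := hend x hx
      rw [ht, he]
      exact layer_ne_hub _
    · rw [ht]
      exact filler_ne_hub _ _
    · rw [ht]
      exact filler_ne_hub _ _
  refine isKPathPairable_of_hubs (a := b + 1) (Finset.univ.image hub) t W
    (fun p => Finset.univ.filter fun q => ∃ h, p = filler (h.castLE hf) ∧ q = hub h)
    ?_ ?_ ?_ ?_ ?_ ?_ hk
  · rw [Finset.card_image_of_injective _ hub_injective, Finset.card_univ, Fintype.card_fin]
    omega
  · intro v hv
    obtain ⟨h, -, hh⟩ := Finset.mem_image.1 hv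
    exact ht v h hh.symm
  · intro v q hq
    obtain ⟨h, -, rfl⟩ := Finset.mem_image.1 hq
    rcases hspec v with ⟨x, -, hx, -, ht, -⟩ | ⟨j, -, ht, -⟩ | ⟨h', -, ht, -⟩
    · obtain ⟨hu, he⟩ := hend x hx
      rw [ht, he]
      exact layeredGraph_adj.2 (Or.inl (.last _ _ _ _))
    · rw [ht]
      exact layeredGraph_adj.2 (Or.inl (.filler _ _))
    · rw [ht]
      exact layeredGraph_adj.2 (Or.inl (.filler _ _))
  · intro v w hvw e he he'
    rcases hspec v with ⟨x, hxb, hx, rfl, -, hW⟩ | ⟨j, -, -, hW⟩ | ⟨h, rfl, -, hW⟩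
    · obtain ⟨q, hq, rfl⟩ := hW e he
      rcases hspec w with ⟨y, hyb, hy, rfl, -, hW'⟩ | ⟨j, -, -, hW'⟩ | ⟨h, rfl, -, hW'⟩
      · obtain ⟨q', hq', hee⟩ := hW' _ he'
        exact hvw (congrArg _ (Token.eq_of_iterate_next_eq hxb hyb
          (token_eq_of_edge_eq (hstep x q hq) (hstep y q' hq') hee)))
      · simp [hW'] at he'
      · exact hnohub _ (hstep x q hq) _ _ (hW' _ he').symm
    · simp [hW] at he
    · have hee := hW e he
      rcases hspec w with ⟨y, hyb, hy, rfl, -, hW'⟩ | ⟨j, -, -, hW'⟩ | ⟨h', rfl, -, hW'⟩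
      · obtain ⟨q', hq', hee'⟩ := hW' _ he'
        exact hnohub _ (hstep y q' hq') _ _ (hee.symm.trans hee')
      · simp [hW'] at he'
      · have := hee.symm.trans (hW' _ he')
        rw [Sym2.eq_iff] at this
        rcases this with ⟨-, h1⟩ | ⟨h1, -⟩
        · exact hvw h1
        · exact filler_ne_hub _ _ h1
  · intro v p q hq he
    obtain ⟨h, -, rfl⟩ := Finset.mem_image.1 hq
    rcases hspec v with ⟨x, -, hx, -, -, hW⟩ | ⟨j, -, -, hW⟩ | ⟨h', -, -, hW⟩
    · obtain ⟨q', hq', hee⟩ := hW _ he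
      exact absurd hee (hnohub _ (hstep x q' hq') _ _)
    · simp [hW] at he
    · have hee := hW _ he
      rw [Sym2.eq_iff] at hee
      rcases hee with ⟨h1, h2⟩ | ⟨h1, -⟩
      · rw [hub_injective h2, h1]
        simp only [Finset.mem_filter, Finset.mem_univ, true_and]
        exact ⟨h', rfl, rfl⟩
      · exact absurd h1 (ht _ _)
  · intro v
    -- at most one edge of a filler is used by a hub
    have hF : ∀ p : Vertex b m f, (Finset.univ.filter fun q : Vertex b m f => ∃ h : Fin (2 * b + 1),
        p = filler (h.castLE hf) ∧ q = hub h).card ≤ 1 := by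
      intro p
      rw [Finset.card_le_one]
      simp only [Finset.mem_filter, Finset.mem_univ, true_and]
      rintro _ ⟨h, rfl, rfl⟩ _ ⟨h', hh, rfl⟩
      rw [Fin.castLE_injective hf (filler_injective hh)]
    have hfill : ∀ j, t v = filler j → (Finset.univ.filter fun w => t w = t v).card +
        (Finset.univ.filter fun q : Vertex b m f => ∃ h : Fin (2 * b + 1),
          t v = filler (h.castLE hf) ∧ q = hub h).card ≤ b + 1 := by
      intro j hj
      have hsub : (Finset.univ.filter fun w => t w = t v) ⊆ insert (filler j)
          (Finset.univ.filter fun q : Vertex b m f => ∃ h : Fin (2 * b + 1),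
            t v = filler (h.castLE hf) ∧ q = hub h) := by
        intro w hw
        simp only [Finset.mem_filter, Finset.mem_univ, true_and, Finset.mem_insert] at hw ⊢
        rcases hspec w with ⟨x, -, hx, -, htw, -⟩ | ⟨j', rfl, htw, -⟩ | ⟨h, rfl, htw, -⟩
        · obtain ⟨hu, he⟩ := hend x hx
          rw [htw, he, hj] at hw
          exact absurd hw (layer_ne_filler _)
        · left
          rw [← htw, hw, hj]
        · exact Or.inr ⟨h, by rw [← hw, htw], rfl⟩
      have h1 := (Finset.card_le_card hsub).trans (Finset.card_insert_le _ _)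
      have h2 := hF (t v)
      omega
    rcases hspec v with ⟨x, -, hx, -, htv, -⟩ | ⟨j, -, htv, -⟩ | ⟨h, -, htv, -⟩
    · obtain ⟨hu, he⟩ := hend x hx
      have h0 : (Finset.univ.filter fun q : Vertex b m f => ∃ h : Fin (2 * b + 1),
          t v = filler (h.castLE hf) ∧ q = hub h) = ∅ := by
        rw [Finset.filter_eq_empty_iff]
        rintro q - ⟨h, hh, -⟩
        rw [htv, he] at hh
        exact layer_ne_filler _ hh
      rw [h0, Finset.card_empty, add_zero]
      -- the tokens that end at the same vertex occupy different slots
      refine le_trans (Finset.card_le_card_of_forall_subsingleton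
        (fun w j => ∃ y : Token b, y.slot = b ∧ y.level ≤ m ∧ w = pos y ∧
          t w = pos (Token.next^[m - y.level] y) ∧ (Token.next^[m - y.level] y).slot = j)
        (t := Finset.range (b + 1)) ?_ ?_) (Finset.card_range _).le
      · intro w hw
        simp only [Finset.mem_filter, Finset.mem_univ, true_and] at hw
        rcases hspec w with ⟨y, hyb, hy, hwy, htw, -⟩ | ⟨j, -, htw, -⟩ | ⟨h, -, htw, -⟩
        · exact ⟨_, Finset.mem_range.2 (Nat.lt_succ_of_le (Token.slot_le _)),
            y, hyb, hy, hwy, htw, rfl⟩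
        · rw [htw, htv, he] at hw
          exact absurd hw.symm (layer_ne_filler _)
        · rw [htw, htv, he] at hw
          exact absurd hw.symm (layer_ne_filler _)
      · rintro j - w ⟨hw, y, hyb, hy, rfl, hty, hyj⟩ w' ⟨hw', y', hyb', hy', rfl, hty', hyj'⟩
        simp only [Finset.mem_filter, Finset.mem_univ, true_and] at hw hw'
        have hpos := hty.symm.trans (hw.trans (hw'.symm.trans hty'))
        obtain ⟨hu, he⟩ := hend y hy
        obtain ⟨hu', he'⟩ := hend y' hy'
        rw [he, he', layer_inj] at hpos
        refine congrArg _ (Token.eq_of_iterate_next_eq hyb hyb'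
          (p := m - y.level) (q := m - y'.level) (Token.ext ?_ ?_ hpos.2.2 (hyj.trans hyj'.symm)))
        · rw [Token.copy_iterate_next, Token.copy_iterate_next]
          exact hpos.1
        · rw [Token.level_iterate_next, Token.level_iterate_next]
          omega
    · exact hfill j htv
    · exact hfill _ htv

end LayeredGraph

/-! ### Graphs of every large order -/

theorem sum_layerSize_le {b : ℕ} [NeZero b] (k : ℕ) :
    ∑ i ∈ Finset.range k, (layerSize b i : ℝ) ≤ 2 * b ^ 2 * (((b : ℝ) + 1) / b) ^ k := by
  have hb' : (0 : ℝ) < b := by exact_mod_cast NeZero.pos b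
  induction k with
  | zero => simp
  | succ k ih =>
    rw [Finset.sum_range_succ]
    have h1 := layerSize_add_le (b := b) k
    have h2 : 2 * (b : ℝ) ^ 2 * (((b : ℝ) + 1) / b) ^ (k + 1) =
        2 * b ^ 2 * (((b : ℝ) + 1) / b) ^ k + 2 * b * (((b : ℝ) + 1) / b) ^ k := by
      rw [pow_succ _ k]
      generalize (((b : ℝ) + 1) / b) ^ k = q
      field_simp
    linarith

theorem IsDegenerate.mono {V : Type*} [Fintype V] {G : SimpleGraph V} {c c' : ℕ} (hc : c ≤ c')
    (h : IsDegenerate c G) : IsDegenerate c' G := by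
  obtain ⟨v, hv⟩ := h
  exact ⟨v, fun i => (hv i).trans hc⟩

/-- The filler vertices bring the layered graph to any given, sufficiently large order. -/
theorem exists_pathPairable_of_le {b n m : ℕ} (hb : 2 ≤ b)
    (hn : 2 * ∑ i ∈ Finset.range (m + 1), layerSize b i + 2 * (2 * b + 1) ≤ n) :
    ∃ G : SimpleGraph (Fin n), IsDegenerate (2 * b + 1) G ∧ IsPathPairable G ∧
      ((2 * m + 2 : ℕ) : ℕ∞) ≤ G.ediam := by
  have : NeZero b := ⟨by omega⟩
  obtain ⟨f, hf⟩ := Nat.exists_eq_add_of_le hn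
  have hcard : Fintype.card (Vertex b m (2 * b + 1 + f)) = n := by
    rw [card_vertex]
    omega
  let e := Fintype.equivFinOfCardEq hcard
  let φ := SimpleGraph.Iso.map e (layeredGraph b m (2 * b + 1 + f))
  refine ⟨_, isDegenerate_layeredGraph.of_iso φ, ⟨n / 2, ?_, ?_⟩,
    le_ediam_layeredGraph.trans (ediam_le_of_iso φ)⟩
  · rw [Fintype.card_fin]
    omega
  · refine (isKPathPairable_layeredGraph hb (by omega) ?_).of_iso φ
    rw [hcard]
    omega

theorem two_mul_le_maxDiam {c b n p : ℕ} (hb : 2 ≤ b) (hbc : 2 * b + 1 ≤ c)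
    (hn : (4 * (b : ℝ) ^ 2 + 2 * (2 * b + 1)) * (((b : ℝ) + 1) / b) ^ p ≤ n) :
    2 * p ≤ maxDiam n (degenerateFamily c) := by
  have : NeZero b := ⟨by omega⟩
  have hb' : (0 : ℝ) < b := by exact_mod_cast NeZero.pos b
  cases p with
  | zero => exact Nat.zero_le _
  | succ m =>
    have h1 := sum_layerSize_le (b := b) (m + 1)
    have h2 : (1 : ℝ) ≤ (((b : ℝ) + 1) / b) ^ (m + 1) :=
      one_le_pow₀ ((one_le_div hb').2 (by linarith))
    have h3 : ((2 * ∑ i ∈ Finset.range (m + 1), layerSize b i + 2 * (2 * b + 1) : ℕ) : ℝ) ≤ n := by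
      push_cast
      nlinarith
    have h4 : 2 * ∑ i ∈ Finset.range (m + 1), layerSize b i + 2 * (2 * b + 1) ≤ n := by
      exact_mod_cast h3
    obtain ⟨G, hG, hpair, hD⟩ := exists_pathPairable_of_le hb h4
    have h5 := (isGreatest_maxDiam (c := c) (n := n) (by omega) (by omega)).2
      ⟨G, hG.mono hbc, hpair, rfl⟩
    have h6 : ((2 * m + 2 : ℕ) : ℕ∞) ≤ (maxDiam n (degenerateFamily c) : ℕ∞) := hD.trans h5
    have h7 : 2 * m + 2 ≤ maxDiam n (degenerateFamily c) := by exact_mod_cast h6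
    omega

/-! ### Asymptotics -/

theorem exists_sub_le_maxDiam {c : ℕ} (hc : 5 ≤ c) : ∃ K : ℝ, ∀ᶠ n : ℕ in atTop,
    2 * (Real.log n / Real.log ((c : ℝ) / ((c : ℝ) - 2))) - K ≤
      maxDiam n (degenerateFamily c) := by
  -- the largest `b` for which there may be `2b + 1` hubs
  obtain ⟨b, hb⟩ : ∃ b, b = (c - 1) / 2 := ⟨_, rfl⟩
  have hc' : (5 : ℝ) ≤ c := by exact_mod_cast hc
  have hb' : (2 : ℝ) ≤ b := by exact_mod_cast (by omega : 2 ≤ b)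
  have hcb : (c : ℝ) ≤ 2 * b + 2 := by exact_mod_cast (by omega : c ≤ 2 * b + 2)
  set lam : ℝ := ((b : ℝ) + 1) / b with hlam
  set C : ℝ := 4 * (b : ℝ) ^ 2 + 2 * (2 * b + 1) with hC
  have hlam1 : 1 < lam := by
    rw [hlam, one_lt_div (by linarith)]
    linarith
  have hlamμ : lam ≤ (c : ℝ) / ((c : ℝ) - 2) := by
    rw [hlam, div_le_div_iff₀ (by linarith) (by linarith)]
    nlinarith
  have hlog : 0 < Real.log lam := Real.log_pos hlam1
  have hlogle : Real.log lam ≤ Real.log ((c : ℝ) / ((c : ℝ) - 2)) :=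
    Real.log_le_log (by linarith) hlamμ
  have hCpos : 0 < C := by positivity
  refine ⟨2 * (Real.log C / Real.log lam + 1), ?_⟩
  filter_upwards [eventually_ge_atTop ⌈C⌉₊, eventually_ge_atTop 1] with n hn hn1
  have hn : C ≤ n := Nat.ceil_le.1 hn
  have hn1 : (1 : ℝ) ≤ n := by exact_mod_cast hn1
  set y := (Real.log n - Real.log C) / Real.log lam with hy
  have hy0 : 0 ≤ y := div_nonneg (sub_nonneg.2 (Real.log_le_log hCpos hn)) hlog.le
  have hfl : (⌊y⌋₊ : ℝ) ≤ y := Nat.floor_le hy0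
  have hfl' : y < ⌊y⌋₊ + 1 := Nat.lt_floor_add_one y
  have hpow : C * lam ^ ⌊y⌋₊ ≤ n := by
    rw [← Real.log_le_log_iff (by positivity) (by linarith), Real.log_mul hCpos.ne'
      (by positivity), Real.log_pow]
    have := mul_le_mul_of_nonneg_right hfl hlog.le
    rw [hy, div_mul_cancel₀ _ hlog.ne', ← hy] at this
    linarith
  have hmain := two_mul_le_maxDiam (c := c) (by omega : 2 ≤ b) (by omega) hpow
  have hmain : 2 * (⌊y⌋₊ : ℝ) ≤ maxDiam n (degenerateFamily c) := by exact_mod_cast hmain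
  have hle : Real.log n / Real.log ((c : ℝ) / ((c : ℝ) - 2)) ≤ Real.log n / Real.log lam :=
    div_le_div_of_nonneg_left (Real.log_nonneg hn1) hlog hlogle
  have hy' : y = Real.log n / Real.log lam - Real.log C / Real.log lam := by rw [hy, sub_div]
  linarith

theorem log_div_le {c : ℕ} (hc : 5 ≤ c) :
    Real.log ((c : ℝ) / ((c : ℝ) - 2)) ≤ 6 * Real.log (1 + 1 / (c : ℝ)) := by
  have hc' : (5 : ℝ) ≤ c := by exact_mod_cast hc
  have h0 : (0 : ℝ) < 1 / c := by positivity
  have h1 : 1 + 6 * (1 / (c : ℝ)) ≤ (1 + 1 / (c : ℝ)) ^ 6 := by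
    have := one_add_mul_le_pow (a := 1 / (c : ℝ)) (by linarith) 6
    exact_mod_cast this
  have h2 : (c : ℝ) / ((c : ℝ) - 2) ≤ 1 + 6 * (1 / (c : ℝ)) := by
    rw [mul_one_div, one_add_div (by positivity), div_le_div_iff₀ (by linarith) (by linarith)]
    nlinarith
  rw [show (6 : ℝ) = ((6 : ℕ) : ℝ) by norm_num, ← Real.log_pow]
  exact Real.log_le_log (div_pos (by linarith) (by linarith)) (h2.trans h1)

theorem exists_maxDiam_le_add {c : ℕ} (hc : 5 ≤ c) : ∃ K : ℝ, ∀ᶠ n : ℕ in atTop,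
    (maxDiam n (degenerateFamily c) : ℝ) ≤
      12 * (Real.log n / Real.log ((c : ℝ) / ((c : ℝ) - 2))) + K := by
  have hc' : (5 : ℝ) ≤ c := by exact_mod_cast hc
  have hlog : 0 < Real.log (1 + 1 / (c : ℝ)) := by
    refine Real.log_pos ?_
    have : (0 : ℝ) < 1 / c := by positivity
    linarith
  have hlogμ : 0 < Real.log ((c : ℝ) / ((c : ℝ) - 2)) := by
    refine Real.log_pos ?_
    rw [one_lt_div (by linarith)]
    linarith
  refine ⟨2 * (Real.log (c + 1) / Real.log (1 + 1 / (c : ℝ))) + 2, ?_⟩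
  filter_upwards [eventually_ge_atTop 1] with n hn
  have : Nonempty (Fin n) := ⟨⟨0, hn⟩⟩
  have hn1 : (1 : ℝ) ≤ n := by exact_mod_cast hn
  obtain ⟨G, hG, hpair, hD⟩ := (isGreatest_maxDiam (c := c) (by omega) hn).1
  obtain ⟨t, ht, hpow⟩ := exists_pow_le_of_ediam_eq (by omega) hG hpair hD
  rw [Fintype.card_fin] at hpow
  have ht' : (maxDiam n (degenerateFamily c) : ℝ) ≤ 2 * t + 2 := by exact_mod_cast ht
  have h1 := Real.log_le_log (by positivity) hpow
  rw [Real.log_pow, Real.log_mul (by positivity) (by positivity), ← le_div_iff₀ hlog,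
    add_div] at h1
  have h2 : Real.log n / Real.log (1 + 1 / (c : ℝ)) ≤
      6 * (Real.log n / Real.log ((c : ℝ) / ((c : ℝ) - 2))) := by
    rw [mul_div_assoc', div_le_div_iff₀ hlog hlogμ]
    have := mul_le_mul_of_nonneg_left (log_div_le hc) (Real.log_nonneg hn1)
    linarith
  linarith

end PathPairability

/-- The first conjunct says that `d(n, 𝒢)` is a genuine (attained, finite) maximum; the second one
is the pair of asymptotic bounds. -/
theorem theorem2 (c : ℕ) (hc : 5 ≤ c) :
    (∀ n : ℕ, 1 ≤ n →
      IsGreatest (PathPairability.diameters n (PathPairability.degenerateFamily c))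
        (PathPairability.maxDiam n (PathPairability.degenerateFamily c) : ℕ∞)) ∧
    ∃ ε₁ ε₂ : ℕ → ℝ, Tendsto ε₁ atTop (𝓝 0) ∧ Tendsto ε₂ atTop (𝓝 0) ∧
      ∀ᶠ n : ℕ in atTop,
        (2 + ε₁ n) * (Real.log (n : ℝ) / Real.log ((c : ℝ) / ((c : ℝ) - 2))) ≤
            (PathPairability.maxDiam n (PathPairability.degenerateFamily c) : ℝ) ∧
        (PathPairability.maxDiam n (PathPairability.degenerateFamily c) : ℝ) ≤
            (12 + ε₂ n) * (Real.log (n : ℝ) / Real.log ((c : ℝ) / ((c : ℝ) - 2))) := by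
  refine ⟨fun n hn => PathPairability.isGreatest_maxDiam (by omega) hn, ?_⟩
  obtain ⟨K₁, h₁⟩ := PathPairability.exists_sub_le_maxDiam hc
  obtain ⟨K₂, h₂⟩ := PathPairability.exists_maxDiam_le_add hc
  have hlogμ : 0 < Real.log ((c : ℝ) / ((c : ℝ) - 2)) := by
    have hc' : (5 : ℝ) ≤ c := by exact_mod_cast hc
    refine Real.log_pos ?_
    rw [one_lt_div (by linarith)]
    linarith
  have hL : Tendsto (fun n : ℕ => Real.log (n : ℝ) / Real.log ((c : ℝ) / ((c : ℝ) - 2)))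
      atTop atTop :=
    (Real.tendsto_log_atTop.comp tendsto_natCast_atTop_atTop).atTop_div_const hlogμ
  refine ⟨fun n => -K₁ / (Real.log (n : ℝ) / Real.log ((c : ℝ) / ((c : ℝ) - 2))),
    fun n => K₂ / (Real.log (n : ℝ) / Real.log ((c : ℝ) / ((c : ℝ) - 2))),
    tendsto_const_nhds.div_atTop hL, tendsto_const_nhds.div_atTop hL, ?_⟩
  filter_upwards [h₁, h₂, hL.eventually_gt_atTop 0] with n hn₁ hn₂ hpos
  rw [add_mul, add_mul, div_mul_cancel₀ _ hpos.ne', div_mul_cancel₀ _ hpos.ne']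
  exact ⟨by linarith, hn₂⟩
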